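/- **Theorem (Generalisation of MKNF models).** Let $\mathcal K$ be an updatable hybrid knowledge base and let $M$ be an MKNF interpretation. Then $M$ is a dynamic MKNF model of the one-element sequence $\langle\mathcal K\rangle$ if and only if $M$ is an MKNF model of $\mathcal K$. The notions used are the following. *MKNF.* Fix a function-free first-order signature with a set $\mathbf P$ of predicate symbols and an infinite set $\Delta$ of constants. MKNF formulae are built from atoms $P(t_1,\dots,t_n)$ with $\neg,\wedge,\exists$ and the modal operators $\mathbf K$, $\mathbf{not}$; $\mathsf{pr}(\cdot)$ denotes the set of predicate symbols occurring in an expression. An interpretation is a set of ground atoms; $\mathcal I$ is the set of all interpretations; an MKNF interpretation is a nonempty subset of $\mathcal I$. For $I\in\mathcal I$ and $M,N\subseteq\mathcal I$: $(I,M,N)\models p$ iff $p\in I$ (for a ground atom $p$); $\neg,\wedge$ are as usual; $(I,M,N)\models\exists x\,\varphi$ iff $(I,M,N)\models\varphi[c/x]$ for some $c\in\Delta$; $(I,M,N)\models\mathbf K\varphi$ iff $(J,M,N)\models\varphi$ for all $J\in M$; $(I,M,N)\models\mathbf{not}\,\varphi$ iff $(J,M,N)\not\models\varphi$ for some $J\in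 N$. For a set $T$ of sentences, $M\models T$ means $(I,M,M)\models\varphi$ for all $\varphi\in T$, $I\in M$. An MKNF interpretation $M$ is an MKNF model of $T$ if $M\models T$ and for every $M'\supsetneq M$ there are $I'\in M'$ and $\varphi\in T$ with $(I',M',M)\not\models\varphi$. For a first-order theory $T$, $\mathsf{mod}(T)$ is the greatest $M\subseteq\mathcal I$ with $M\models T$. *Hybrid knowledge bases.* A literal is a ground atom $p$ or a default literal ${\sim}p$ (with ${\sim}{\sim}p=p$). A rule $r$ has a head literal $H(r)$ and a finite set $B(r)$ of body literals; it is positive if its head is an atom and a fact if $B(r)=\emptyset$. A program is a set of rules. A hybrid knowledge base is a pair $\mathcal K=\langle\mathcal O,\mathcal P\rangle$ of an ontology, that is, a set of description logic axioms $\varphi$ each with a first-order translation $\kappa(\varphi)$ (and $\mathsf{pr}(\varphi)=\mathsf{pr}(\kappa(\varphi))$), and a program. Put $\pi(p)=\mathbf Kp$, $\pi({\sim}p)=\mathbf{not}\,p$, $\pi(r)=\bigl(\bigwedge_{L\in B(r)}\pi(L)\supset\pi(H(r))\bigr)$, $\pi(\mathcal K)=\{\mathbf K\kappa(\varphi)\mid\varphi\in\mathcal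 O\}\cup\{\pi(r)\mid r\in\mathcal P\}$. An MKNF model of $\mathcal K$ is an MKNF model of $\pi(\mathcal K)$. A dynamic hybrid knowledge base is a finite sequence of hybrid knowledge bases. *Splitting.* $U\subseteq\mathbf P$ is a splitting set for $\mathcal K$ if $\mathsf{pr}(\varphi)\subseteq U$ for all $\varphi\in\mathcal O$ with $\mathsf{pr}(\varphi)\cap U\ne\emptyset$, and $\mathsf{pr}(r)\subseteq U$ for all $r\in\mathcal P$ with $\mathsf{pr}(H(r))\cap U\neq\emptyset$. The bottom $b_U(\mathcal K)$ consists of the axioms and rules of $\mathcal K$ with all predicate symbols in $U$, the top $t_U(\mathcal K)$ of the others. For $X\subseteq\mathcal I$, the reduct $e_U(\mathcal K,X)$ has the ontology of $t_U(\mathcal K)$ and all rules $r'$ for which there is a rule $r$ of $t_U(\mathcal K)$ with $X\models\{\pi(L)\mid L\in B(r),\ \mathsf{pr}(L)\subseteq U\}$, $H(r')=H(r)$ and $B(r')=\{L\in B(r)\mid\mathsf{pr}(L)\subseteq\mathbf P\setminus U\}$. A splitting sequence for $\mathcal K$ is a nonempty monotone sequence $\langle U_\alpha\rangle_{\alpha<\mu}$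 of splitting sets for $\mathcal K$, indexed by the ordinals below an ordinal $\mu$, with $U_\alpha=\bigcup_{\beta<\alpha}U_\beta$ at limit ordinals $\alpha<\mu$ and with $\bigcup_{\alpha<\mu}U_\alpha=\mathbf P$. $\mathcal K$ is reducible relative to $U$ if either all its rules are positive with $\mathsf{pr}(B(r))\subseteq U$, or its ontology is empty; a sequence of knowledge bases is reducible relative to $U$ if the first alternative holds for all its members or the second one does. The sequence $\langle U_\alpha\rangle_{\alpha<\mu}$ is update-enabling if $b_{U_0}(\mathcal K)$ is reducible relative to $\emptyset$ and $t_{U_\alpha}(b_{U_{\alpha+1}}(\mathcal K))$ is reducible relative to $U_\alpha$ whenever $\alpha+1<\mu$; $\mathcal K$ is updatable if it has an update-enabling splitting sequence. For dynamic hybrid knowledge bases, $b_U,t_U,e_U$ are taken memberwise, a splitting sequence has to be one for every member, and update-enabling and updatable are defined by the same words. *Updates of theories and programs.* For $I,J,J'\in\mathcal I$, $J\le_IJ'$ means that for every $P\in\mathbf P$ the set of atoms with predicate symbol $P$ on which $I,J$ differ is contained in the one on which $I,J'$ differ; $J<_IJ'$ means $J\le_IJ'$ and not $J'\le_IJ$.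 For $M,N\subseteq\mathcal I$ put $M\oplus N=\bigcup_{I\in M}\{J\in N\mid\text{no }J'\in N\text{ has }J'<_IJ\}$. The minimal change update model of first-order theories $\langle T_i\rangle_{i<n}$ is $(\cdots(\mathsf{mod}(T_0)\oplus\mathsf{mod}(T_1))\oplus\cdots)\oplus\mathsf{mod}(T_{n-1})$, provided that this set is nonempty. Given programs $\langle\mathcal P_i\rangle_{i<n}$ and $I\in\mathcal I$, an occurrence of a rule $r$ in $\mathcal P_i$ is rejected if some $\mathcal P_j$ with $i\le j$ contains a rule $r'$ with $H(r)={\sim}H(r')$ and $I\models B(r')$. $I$ is a dynamic stable model of $\langle\mathcal P_i\rangle_{i<n}$ if $I\cup\{\mathit{not}\_p\mid p\notin I\}$ is the least model of the program that consists of the rules with a non-rejected occurrence and the facts ${\sim}p$ for those atoms $p$ for which no rule $r$ of any $\mathcal P_i$ has $H(r)=p$ and $I\models B(r)$, every default literal ${\sim}p$ being read as a fresh atom $\mathit{not}\_p$. *Dynamic MKNF models.* A dynamic hybrid knowledge base $\langle\mathcal O_i,\mathcal P_i\rangle_{i<n}$ is $\mathcal O$-based if every $\mathcal P_i$ contains only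 positive facts, $\mathcal P$-based if every $\mathcal O_i$ is empty, and basic if it is one of the two. An MKNF interpretation $M$ is a dynamic MKNF model of a basic one if either it is $\mathcal O$-based and $M$ is the minimal change update model of $\langle\kappa(\mathcal O_i)\cup\mathcal P_i\rangle_{i<n}$ (positive facts being read as ground atoms), or it is $\mathcal P$-based and $M=\{J\in\mathcal I\mid I\subseteq J\}$ for some dynamic stable model $I$ of $\langle\mathcal P_i\rangle_{i<n}$. An MKNF interpretation $M$ is a dynamic MKNF model of an updatable dynamic hybrid knowledge base $\mathcal K$ if, for some update-enabling splitting sequence $\langle U_\alpha\rangle_{\alpha<\mu}$ for $\mathcal K$, $M=\bigcap_{\alpha<\mu}X_\alpha$ for some sequence of MKNF interpretations $\langle X_\alpha\rangle_{\alpha<\mu}$ such that $X_0$ is a dynamic MKNF model of $b_{U_0}(\mathcal K)$, $X_{\alpha+1}$ is a dynamic MKNF model of $e_{U_\alpha}\bigl(b_{U_{\alpha+1}}(\mathcal K),\bigcap_{\eta\le\alpha}X_\eta\bigr)$ whenever $\alpha+1<\mu$, and $X_\alpha=\mathcal I$ for limit ordinals $\alpha<\mu$. -/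

import Mathlib

universe u v w

namespace HybridMKNF

/-- A function-free first-order signature: predicate symbols with arities, and infinitely many
constants. By the standard names assumption the Herbrand universe is the set of constants. -/
structure Signature where
  Pred : Type u
  arity : Pred → ℕ
  Const : Type v
  const_infinite : Infinite Const

/-- Terms whose variables are among `n` variables (de Bruijn indices). -/
inductive Term (σ : Signature.{u, v}) (n : ℕ) : Type v
  | var (i : Fin n) : Term σ n
  | const (c : σ.Const) : Term σ n

/-- MKNF formulae whose free variables are among `n` variables (de Bruijn indices: in `ex φ` the
bound variable is the variable `0` of `φ`). `know` and `mnot` are the modal operators `K`, `not`. -/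
inductive Formula (σ : Signature.{u, v}) : ℕ → Type (max u v)
  | atom {n : ℕ} (P : σ.Pred) (t : Fin (σ.arity P) → Term σ n) : Formula σ n
  | neg {n : ℕ} (φ : Formula σ n) : Formula σ n
  | conj {n : ℕ} (φ ψ : Formula σ n) : Formula σ n
  | ex {n : ℕ} (φ : Formula σ (n + 1)) : Formula σ n
  | know {n : ℕ} (φ : Formula σ n) : Formula σ n
  | mnot {n : ℕ} (φ : Formula σ n) : Formula σ n

/-- MKNF sentences: formulae without free variables. -/
abbrev Sentence (σ : Signature.{u, v}) := Formula σ 0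

/-- Ground atoms. -/
structure GroundAtom (σ : Signature.{u, v}) where
  pred : σ.Pred
  args : Fin (σ.arity pred) → σ.Const

/-- Herbrand interpretations. An element of `Set (Interp σ)` is an MKNF interpretation if it is
nonempty. -/
abbrev Interp (σ : Signature.{u, v}) := Set (GroundAtom σ)

section Semantics

variable {σ : Signature.{u, v}}

/-- The value of a term when the variable `i` stands for the constant `e i`. -/
def Term.eval {n : ℕ} (e : Fin n → σ.Const) : Term σ n → σ.Const
  | .var i => e i
  | .const c => c

/-- The predicate symbols occurring in a formula. -/
def Formula.preds : {n : ℕ} → Formula σ n → Set σ.Pred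
  | _, .atom P _ => {P}
  | _, .neg φ => φ.preds
  | _, .conj φ ψ => φ.preds ∪ ψ.preds
  | _, .ex φ => φ.preds
  | _, .know φ => φ.preds
  | _, .mnot φ => φ.preds

/-- A formula is first-order if it contains no modal operator. -/
def Formula.IsFirstOrder : {n : ℕ} → Formula σ n → Prop
  | _, .atom _ _ => True
  | _, .neg φ => φ.IsFirstOrder
  | _, .conj φ ψ => φ.IsFirstOrder ∧ ψ.IsFirstOrder
  | _, .ex φ => φ.IsFirstOrder
  | _, .know _ => False
  | _, .mnot _ => False

/-- `φ.Sat e I M N`: the MKNF structure `(I, M, N)` satisfies the sentence obtained from `φ` by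
replacing every free variable `i` by the constant `e i`. -/
def Formula.Sat : {n : ℕ} → Formula σ n → (Fin n → σ.Const) →
    Interp σ → Set (Interp σ) → Set (Interp σ) → Prop
  | _, .atom P t, e, I, _, _ => (⟨P, fun i => (t i).eval e⟩ : GroundAtom σ) ∈ I
  | _, .neg φ, e, I, M, N => ¬ φ.Sat e I M N
  | _, .conj φ ψ, e, I, M, N => φ.Sat e I M N ∧ ψ.Sat e I M N
  | _, .ex φ, e, I, M, N => ∃ c : σ.Const, φ.Sat (Fin.cons c e) I M N
  | _, .know φ, e, _, M, N => ∀ J ∈ M, φ.Sat e J M N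
  | _, .mnot φ, e, _, M, N => ∃ J ∈ N, ¬ φ.Sat e J M N

/-- Satisfaction of a sentence in the MKNF structure `(I, M, N)`. -/
def Sentence.Holds (φ : Sentence σ) (I : Interp σ) (M N : Set (Interp σ)) : Prop :=
  Formula.Sat φ Fin.elim0 I M N

/-- `M ⊨ T`, for a possibly empty set `M` of interpretations. -/
def Entails (M : Set (Interp σ)) (T : Set (Sentence σ)) : Prop :=
  ∀ φ ∈ T, ∀ I ∈ M, Sentence.Holds φ I M M

/-- `M` is an S5 model of `T`. -/
def IsS5Model (T : Set (Sentence σ)) (M : Set (Interp σ)) : Prop :=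
  M.Nonempty ∧ Entails M T

/-- `M` is an MKNF model of `T`. -/
def IsMKNFModel (T : Set (Sentence σ)) (M : Set (Interp σ)) : Prop :=
  IsS5Model T M ∧
    ∀ M' : Set (Interp σ), M'.Nonempty → M ⊂ M' →
      ∃ I' ∈ M', ∃ φ ∈ T, ¬ Sentence.Holds φ I' M' M

/-- `mod T`, the greatest `M` with `M ⊨ T` if there is one (it is then the union of all of them);
there is one for every first-order theory, see `isGreatest_modelSet`. -/
def modelSet (T : Set (Sentence σ)) : Set (Interp σ) :=
  ⋃₀ {M | Entails M T}

theorem Formula.IsFirstOrder.sat_iff {n : ℕ} {φ : Formula σ n} (h : φ.IsFirstOrder)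
    (e : Fin n → σ.Const) (I : Interp σ) (M N M' N' : Set (Interp σ)) :
    φ.Sat e I M N ↔ φ.Sat e I M' N' := by
  induction φ with
  | atom P t => exact Iff.rfl
  | neg φ ih => exact not_congr (ih h e)
  | conj φ ψ ih₁ ih₂ => exact and_congr (ih₁ h.1 e) (ih₂ h.2 e)
  | ex φ ih => exact exists_congr fun c => ih h _
  | know φ ih => exact h.elim
  | mnot φ ih => exact h.elim

theorem isGreatest_modelSet {T : Set (Sentence σ)} (hT : ∀ φ ∈ T, Formula.IsFirstOrder φ) :
    IsGreatest {M | Entails M T} (modelSet T) := by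
  refine ⟨?_, fun M hM => Set.subset_sUnion_of_mem hM⟩
  rintro φ hφ I ⟨M, hM, hI⟩
  exact ((hT φ hφ).sat_iff _ I M M _ _).1 (hM φ hφ I hI)

end Semantics

section MinimalChange

variable {σ : Signature.{u, v}}

/-- The atoms of `I` with predicate symbol `P`. -/
def restrictPred (P : σ.Pred) (I : Interp σ) : Interp σ := {p ∈ I | p.pred = P}

/-- The difference in the interpretation of `P` between `I` and `J`. -/
def predDiff (P : σ.Pred) (I J : Interp σ) : Interp σ :=
  (restrictPred P I \ restrictPred P J) ∪ (restrictPred P J \ restrictPred P I)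

/-- `J` is at least as close to `I` as `J'`. -/
def CloserEq (I J J' : Interp σ) : Prop := ∀ P : σ.Pred, predDiff P I J ⊆ predDiff P I J'

/-- `J` is closer to `I` than `J'`. -/
def Closer (I J J' : Interp σ) : Prop := CloserEq I J J' ∧ ¬ CloserEq I J' J

/-- `M ⊕ N`: those members of `N` that are closest to some member of `M`. -/
def update (M N : Set (Interp σ)) : Set (Interp σ) :=
  ⋃ I ∈ M, {J ∈ N | ¬ ∃ J' ∈ N, Closer I J' J}

/-- `mod ⟨T₀, …, Tₙ₋₁⟩ = (⋯(mod T₀ ⊕ mod T₁) ⊕ ⋯) ⊕ mod Tₙ₋₁`, with the set of all interpretations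
as the starting point (note that `Set.univ ⊕ N = N`). -/
def minimalChange (T : List (Set (Sentence σ))) : Set (Interp σ) :=
  (T.map modelSet).foldl update Set.univ

end MinimalChange

/-- Literals: ground atoms and default literals. -/
inductive Literal (σ : Signature.{u, v}) : Type (max u v)
  | pos (p : GroundAtom σ) : Literal σ
  | dneg (p : GroundAtom σ) : Literal σ

/-- A rule `head ← L₁, …, Lₖ`. -/
structure Rule (σ : Signature.{u, v}) where
  head : Literal σ
  bodyList : List (Literal σ)

/-- Generalised logic programs. -/
abbrev Program (σ : Signature.{u, v}) := Set (Rule σ)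

section Programs

variable {σ : Signature.{u, v}}

/-- The atom underlying a literal. -/
def Literal.base : Literal σ → GroundAtom σ
  | .pos p => p
  | .dneg p => p

/-- Default negation of a literal; double default negation is absorbed. -/
def Literal.compl : Literal σ → Literal σ
  | .pos p => .dneg p
  | .dneg p => .pos p

/-- The set of predicate symbols of a literal. -/
def Literal.preds (L : Literal σ) : Set σ.Pred := {L.base.pred}

/-- Truth of a literal in a Herbrand interpretation. -/
def Literal.TrueIn (I : Interp σ) : Literal σ → Prop
  | .pos p => p ∈ I
  | .dneg p => p ∉ I

/-- The body of a rule, as a set. -/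
def Rule.body (r : Rule σ) : Set (Literal σ) := {L | L ∈ r.bodyList}

/-- The set of predicate symbols of a set of literals. -/
def litPreds (B : Set (Literal σ)) : Set σ.Pred := ⋃ L ∈ B, L.preds

/-- The set of predicate symbols of a rule. -/
def Rule.preds (r : Rule σ) : Set σ.Pred := r.head.preds ∪ litPreds r.body

/-- A rule is positive if its head is an atom. -/
def Rule.IsPositive (r : Rule σ) : Prop := ∃ p, r.head = Literal.pos p

/-- A rule is a fact if its body is empty. -/
def Rule.IsFact (r : Rule σ) : Prop := r.bodyList = []

/-- Two rules are conflicting if the head of one is the default negation of the head of the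
other. -/
def Rule.Conflicts (r r' : Rule σ) : Prop := r.head = r'.head.compl

/-- `I ⊨ B`. -/
def SatBody (I : Interp σ) (B : Set (Literal σ)) : Prop := ∀ L ∈ B, L.TrueIn I

/-- The least model of a program in which every default literal `not p` is read as a new atom
`not_p`. The literals themselves serve as the extended set of atoms. -/
def leastModel (P : Program σ) : Set (Literal σ) :=
  ⋂₀ {S | ∀ r ∈ P, r.body ⊆ S → r.head ∈ S}

/-- `I ∪ {not_p | p ∉ I}`. -/
def extendInterp (I : Interp σ) : Set (Literal σ) := {L | L.TrueIn I}

/-- The occurrence of the rule `r` in the `i`-th program is rejected: a conflicting rule of the same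
or of a later program has a body that is true in `I`. -/
def IsRejected (P : List (Program σ)) (I : Interp σ) (i : Fin P.length) (r : Rule σ) : Prop :=
  ∃ j : Fin P.length, i ≤ j ∧ ∃ r' ∈ P.get j, r.Conflicts r' ∧ SatBody I r'.body

/-- The rules with an occurrence that is not rejected. -/
def survivingRules (P : List (Program σ)) (I : Interp σ) : Program σ :=
  {r | ∃ i : Fin P.length, r ∈ P.get i ∧ ¬ IsRejected P I i r}

/-- The default assumptions `not p`, as facts: those for which no rule with head `p` has a body that
is true in `I`. -/
def defaultFacts (P : List (Program σ)) (I : Interp σ) : Program σ :=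
  {r | r.IsFact ∧ ∃ p, r.head = Literal.dneg p ∧
    ¬ ∃ i : Fin P.length, ∃ r' ∈ P.get i, r'.head = Literal.pos p ∧ SatBody I r'.body}

/-- `I` is a dynamic stable model of the dynamic logic program `P`. -/
def IsDynamicStableModel (P : List (Program σ)) (I : Interp σ) : Prop :=
  extendInterp I = leastModel (survivingRules P I ∪ defaultFacts P I)

/-- A ground atom as a sentence. -/
def GroundAtom.toSentence (p : GroundAtom σ) : Sentence σ :=
  .atom p.pred fun i => .const (p.args i)

/-- `π(p) = K p` and `π(not p) = not p`. -/
def Literal.trans : Literal σ → Sentence σ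
  | .pos p => .know p.toSentence
  | .dneg p => .mnot p.toSentence

/-- `π(r)`, the sentence `π(head) ⊂ ⋀ π(body)`, written with negation and conjunction as
`¬(π(L₁) ∧ (π(L₂) ∧ ⋯ (π(Lₖ) ∧ ¬π(head))))`. -/
def Rule.trans (r : Rule σ) : Sentence σ :=
  .neg (r.bodyList.foldr (fun L φ => .conj L.trans φ) (.neg r.head.trans))

end Programs

/-- The description logic in use: its ontology axioms and their first-order translation. -/
structure DescriptionLogic (σ : Signature.{u, v}) where
  Ax : Type w
  fo : Ax → Sentence σ
  fo_isFirstOrder : ∀ a, Formula.IsFirstOrder (fo a)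

/-- A hybrid knowledge base: an ontology and a generalised logic program. -/
structure HybridKB {σ : Signature.{u, v}} (D : DescriptionLogic.{u, v, w} σ) where
  ont : Set D.Ax
  prog : Program σ

/-- A dynamic hybrid knowledge base. -/
abbrev DynamicKB {σ : Signature.{u, v}} (D : DescriptionLogic.{u, v, w} σ) := List (HybridKB D)

/-- The predicate symbols of an ontology axiom. -/
def DescriptionLogic.preds {σ : Signature.{u, v}} (D : DescriptionLogic.{u, v, w} σ)
    (a : D.Ax) : Set σ.Pred := Formula.preds (D.fo a)

namespace HybridKB

variable {σ : Signature.{u, v}} {D : DescriptionLogic.{u, v, w} σ}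

/-- The set `π(K)` of MKNF sentences. -/
def trans (K : HybridKB D) : Set (Sentence σ) :=
  {φ | ∃ a ∈ K.ont, φ = .know (D.fo a)} ∪ {φ | ∃ r ∈ K.prog, φ = r.trans}

/-- `M` is an MKNF model of the hybrid knowledge base `K`. -/
def IsModel (K : HybridKB D) (M : Set (Interp σ)) : Prop := IsMKNFModel K.trans M

/-- `U` is a splitting set for `K`. -/
def IsSplittingSet (K : HybridKB D) (U : Set σ.Pred) : Prop :=
  (∀ a ∈ K.ont, (D.preds a ∩ U).Nonempty → D.preds a ⊆ U) ∧
    ∀ r ∈ K.prog, (r.head.preds ∩ U).Nonempty → r.preds ⊆ U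

/-- The bottom of `K` relative to `U`. -/
def bottom (U : Set σ.Pred) (K : HybridKB D) : HybridKB D where
  ont := {a ∈ K.ont | D.preds a ⊆ U}
  prog := {r ∈ K.prog | r.preds ⊆ U}

/-- The top of `K` relative to `U`. -/
def top (U : Set σ.Pred) (K : HybridKB D) : HybridKB D where
  ont := K.ont \ (K.bottom U).ont
  prog := K.prog \ (K.bottom U).prog

/-- The splitting set reduct of `K` relative to `U` and `X`. -/
def reduct (U : Set σ.Pred) (X : Set (Interp σ)) (K : HybridKB D) : HybridKB D where
  ont := (K.top U).ont
  prog := {r' | ∃ r ∈ (K.top U).prog,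
    Entails X (Literal.trans '' {L ∈ r.body | L.preds ⊆ U}) ∧
    r'.head = r.head ∧ r'.body = {L ∈ r.body | L.preds ⊆ Uᶜ}}

/-- The program of `K` contains only positive facts. -/
def OntBased (K : HybridKB D) : Prop := ∀ r ∈ K.prog, r.IsPositive ∧ r.IsFact

/-- The ontology of `K` is empty. -/
def ProgBased (K : HybridKB D) : Prop := K.ont = ∅

def OntReducible (K : HybridKB D) (U : Set σ.Pred) : Prop :=
  ∀ r ∈ K.prog, r.IsPositive ∧ litPreds r.body ⊆ U

/-- This does not depend on the set of predicate symbols. -/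
def ProgReducible (K : HybridKB D) (_U : Set σ.Pred) : Prop := K.ont = ∅

def Reducible (K : HybridKB D) (U : Set σ.Pred) : Prop :=
  K.OntReducible U ∨ K.ProgReducible U

/-- The first-order theory of an ontology-based knowledge base: the translated axioms, and the
positive facts read as ground atoms. -/
def foTheory (K : HybridKB D) : Set (Sentence σ) :=
  D.fo '' K.ont ∪
    {φ | ∃ r ∈ K.prog, ∃ p, r.head = Literal.pos p ∧ r.IsFact ∧ φ = p.toSentence}

/-- `⟨U α⟩_{α < μ}` is a splitting sequence for `K`: a nonempty monotone and continuous sequence of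
splitting sets with union the set of all predicate symbols. Values `U α` with `μ ≤ α` play no
role. -/
structure IsSplittingSequence (K : HybridKB D) (μ : Ordinal.{u}) (U : Ordinal.{u} → Set σ.Pred) :
    Prop where
  pos : 0 < μ
  splitting : ∀ α < μ, K.IsSplittingSet (U α)
  monotone : ∀ α β, α ≤ β → β < μ → U α ⊆ U β
  continuous : ∀ α < μ, Order.IsSuccLimit α → U α = ⋃ β < α, U β
  exhaustive : ⋃ α < μ, U α = Set.univ

/-- `⟨U α⟩_{α < μ}` is an update-enabling splitting sequence for `K`. -/
structure IsUpdateEnabling (K : HybridKB D) (μ : Ordinal.{u}) (U : Ordinal.{u} → Set σ.Pred) :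
    Prop where
  isSplittingSequence : K.IsSplittingSequence μ U
  zero : (K.bottom (U 0)).Reducible ∅
  succ : ∀ α, α + 1 < μ → ((K.bottom (U (α + 1))).top (U α)).Reducible (U α)

/-- `K` is updatable. -/
def Updatable (K : HybridKB D) : Prop :=
  ∃ (μ : Ordinal.{u}) (U : Ordinal.{u} → Set σ.Pred), K.IsUpdateEnabling μ U

end HybridKB

namespace DynamicKB

variable {σ : Signature.{u, v}} {D : DescriptionLogic.{u, v, w} σ}

def bottom (U : Set σ.Pred) (K : DynamicKB D) : DynamicKB D := K.map (HybridKB.bottom U)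

def top (U : Set σ.Pred) (K : DynamicKB D) : DynamicKB D := K.map (HybridKB.top U)

def reduct (U : Set σ.Pred) (X : Set (Interp σ)) (K : DynamicKB D) : DynamicKB D :=
  K.map (HybridKB.reduct U X)

def OntBased (K : DynamicKB D) : Prop := ∀ k ∈ K, k.OntBased

def ProgBased (K : DynamicKB D) : Prop := ∀ k ∈ K, k.ProgBased

def Reducible (K : DynamicKB D) (U : Set σ.Pred) : Prop :=
  (∀ k ∈ K, k.OntReducible U) ∨ (∀ k ∈ K, k.ProgReducible U)

/-- `M` is a dynamic MKNF model of the basic dynamic hybrid knowledge base `K` (no `M` is one if `K`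
is not basic). -/
def IsBasicDynamicModel (K : DynamicKB D) (M : Set (Interp σ)) : Prop :=
  M.Nonempty ∧
    ((OntBased K ∧ M = minimalChange (K.map HybridKB.foTheory)) ∨
      (ProgBased K ∧ ∃ I : Interp σ,
        IsDynamicStableModel (K.map HybridKB.prog) I ∧ M = {J | I ⊆ J}))

/-- `⟨U α⟩_{α < μ}` is an update-enabling splitting sequence for `K`. -/
structure IsUpdateEnabling (K : DynamicKB D) (μ : Ordinal.{u}) (U : Ordinal.{u} → Set σ.Pred) :
    Prop where
  isSplittingSequence : ∀ k ∈ K, k.IsSplittingSequence μ U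
  zero : Reducible (bottom (U 0) K) ∅
  succ : ∀ α, α + 1 < μ → Reducible (top (U α) (bottom (U (α + 1)) K)) (U α)

/-- `⟨X α⟩_{α < μ}` is a solution to `K` with respect to `⟨U α⟩_{α < μ}`. -/
structure IsSolution (K : DynamicKB D) (μ : Ordinal.{u}) (U : Ordinal.{u} → Set σ.Pred)
    (X : Ordinal.{u} → Set (Interp σ)) : Prop where
  nonempty : ∀ α < μ, (X α).Nonempty
  zero : IsBasicDynamicModel (bottom (U 0) K) (X 0)
  succ : ∀ α, α + 1 < μ →
    IsBasicDynamicModel (reduct (U α) (⋂ η ≤ α, X η) (bottom (U (α + 1)) K)) (X (α + 1))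
  limit : ∀ α < μ, Order.IsSuccLimit α → X α = Set.univ

/-- `M` is a dynamic MKNF model of `K` with respect to `⟨U α⟩_{α < μ}`. -/
def IsDynamicModelWrt (K : DynamicKB D) (μ : Ordinal.{u}) (U : Ordinal.{u} → Set σ.Pred)
    (M : Set (Interp σ)) : Prop :=
  M.Nonempty ∧ ∃ X : Ordinal.{u} → Set (Interp σ), IsSolution K μ U X ∧ M = ⋂ α < μ, X α

/-- `M` is a dynamic MKNF model of the updatable dynamic hybrid knowledge base `K`. -/
def IsDynamicModel (K : DynamicKB D) (M : Set (Interp σ)) : Prop :=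
  ∃ (μ : Ordinal.{u}) (U : Ordinal.{u} → Set σ.Pred),
    IsUpdateEnabling K μ U ∧ IsDynamicModelWrt K μ U M

end DynamicKB

end HybridMKNF

/-!
Write `K.SatIn M' M` if `π(K)` holds when its `not`-formulae are evaluated in `M` and the rest in
`M'`. A model of `K` is then a nonempty `M` that is maximal among all `M'` with `K.SatIn M' M`.

Give every predicate symbol the index at which it enters the splitting sequence. Axioms only mention
predicate symbols of one index, and the body of a rule none of a higher index than its head. Every
index thus has a layer, the axioms and rules of that index with the body literals of lower index
evaluated. A model `M` of `K` is the intersection of its saturations, obtained by freeing all atoms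
that do not have a given index. Each saturation is a model of its layer evaluated at the lower ones,
and, by induction along the indices, models of the layers conversely intersect in a model of `K`.

The layers are the reducts in the definition of a solution, and no predicate symbol has a limit
index. It remains to compare the two notions of model for a single basic layer. If it is
ontology-based, its greatest model is `mod` of its theory. If it is program-based, its models are
the sets of supersets of its stable models. Here rejection is harmless: if two conflicting rules of
a program have bodies true in `I`, then neither of their heads can be derived, so that `I` is no
dynamic stable model, just as it is no stable one.
-/

namespace HybridMKNF

variable {σ : Signature.{u, v}} {D : DescriptionLogic.{u, v, w} σ}

section PairSatisfaction

/-- Truth of `π(L)` in a structure `(I, M', M)`, which does not depend on `I`. -/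
def Literal.SatIn (M' M : Set (Interp σ)) : Literal σ → Prop
  | .pos p => ∀ J ∈ M', p ∈ J
  | .dneg p => ∃ J ∈ M, p ∉ J

/-- Truth of `π(r)` in a structure `(I, M', M)`, which does not depend on `I`. -/
def Rule.SatIn (M' M : Set (Interp σ)) (r : Rule σ) : Prop :=
  (∀ L ∈ r.body, L.SatIn M' M) → r.head.SatIn M' M

/-- Truth of `π(K)` in all structures `(I, M', M)` with `I ∈ M'` (see `HybridKB.satIn_iff`):
the set `M` of the MKNF semantics evaluates `not`, the candidate `M'` evaluates the rest. -/
def HybridKB.SatIn (M' M : Set (Interp σ)) (K : HybridKB D) : Prop :=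
  (∀ a ∈ K.ont, M' ⊆ modelSet {D.fo a}) ∧ ∀ r ∈ K.prog, r.SatIn M' M

theorem mem_modelSet_iff {T : Set (Sentence σ)} (hT : ∀ φ ∈ T, Formula.IsFirstOrder φ)
    {I : Interp σ} (M N : Set (Interp σ)) :
    I ∈ modelSet T ↔ ∀ φ ∈ T, Sentence.Holds φ I M N := by
  refine ⟨fun hI φ hφ => ((hT φ hφ).sat_iff _ I _ _ M N).1 ((isGreatest_modelSet hT).1 φ hφ I hI),
    fun hI => ?_⟩
  have hentails : Entails {I} T := by
    rintro φ hφ J rfl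
    exact ((hT φ hφ).sat_iff _ J M N _ _).1 (hI φ hφ)
  exact (isGreatest_modelSet hT).2 hentails (Set.mem_singleton I)

theorem DescriptionLogic.mem_modelSet_fo_iff {a : D.Ax} {I : Interp σ} (M N : Set (Interp σ)) :
    I ∈ modelSet {D.fo a} ↔ Sentence.Holds (D.fo a) I M N := by
  rw [mem_modelSet_iff (by simpa using D.fo_isFirstOrder a) M N]
  exact forall_eq

theorem Literal.holds_trans (L : Literal σ) (I : Interp σ) (M' M : Set (Interp σ)) :
    Sentence.Holds L.trans I M' M ↔ L.SatIn M' M := by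
  cases L <;> exact Iff.rfl

theorem Rule.holds_trans (r : Rule σ) (I : Interp σ) (M' M : Set (Interp σ)) :
    Sentence.Holds r.trans I M' M ↔ r.SatIn M' M := by
  have holds_conj (l : List (Literal σ)) :
      Sentence.Holds (l.foldr (fun L φ => .conj L.trans φ) (.neg r.head.trans)) I M' M ↔
        (∀ L ∈ l, L.SatIn M' M) ∧ ¬ r.head.SatIn M' M := by
    induction l with
    | nil =>
      rw [← r.head.holds_trans I M' M]
      exact (and_iff_right (List.forall_mem_nil _)).symm
    | cons L l ih =>
      rw [List.forall_mem_cons, and_assoc, ← ih, ← L.holds_trans I M' M]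
      rfl
  exact (not_congr (holds_conj r.bodyList)).trans not_and_not_right

theorem Literal.SatIn.anti {L : Literal σ} {M₁ M₂ M : Set (Interp σ)} (h : L.SatIn M₂ M)
    (hM : M₁ ⊆ M₂) : L.SatIn M₁ M := by
  cases L with
  | pos p => exact fun J hJ => h J (hM hJ)
  | dneg p => exact h

theorem HybridKB.satIn_iff {K : HybridKB D} {M' M : Set (Interp σ)} (hM' : M'.Nonempty) :
    K.SatIn M' M ↔ ∀ φ ∈ K.trans, ∀ I ∈ M', Sentence.Holds φ I M' M := by
  have know_iff (a : D.Ax) (I : Interp σ) :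
      Sentence.Holds (.know (D.fo a)) I M' M ↔ M' ⊆ modelSet {D.fo a} :=
    forall₂_congr fun J _ => (D.mem_modelSet_fo_iff M' M).symm
  obtain ⟨I₀, hI₀⟩ := hM'
  constructor
  · rintro ⟨hont, hprog⟩ φ (⟨a, ha, rfl⟩ | ⟨r, hr, rfl⟩) I _
    exacts [(know_iff a I).2 (hont a ha), (r.holds_trans I M' M).2 (hprog r hr)]
  · intro h
    exact ⟨fun a ha => (know_iff a I₀).1 (h _ (.inl ⟨a, ha, rfl⟩) I₀ hI₀),
      fun r hr => (r.holds_trans I₀ M' M).1 (h _ (.inr ⟨r, hr, rfl⟩) I₀ hI₀)⟩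

theorem HybridKB.isModel_iff {K : HybridKB D} {M : Set (Interp σ)} :
    K.IsModel M ↔ M.Nonempty ∧ Maximal (fun M' => K.SatIn M' M) M := by
  refine and_assoc.trans (and_congr_right fun hM => and_congr ?_ ?_)
  · exact (satIn_iff hM).symm
  · constructor
    · intro hmax M' hsat hMM'
      by_contra hM'M
      obtain ⟨I, hI, φ, hφ, hnot⟩ := hmax M' (hM.mono hMM') ⟨hMM', hM'M⟩
      exact hnot ((satIn_iff (hM.mono hMM')).1 hsat φ hφ I hI)
    · intro hmax M' hM' hlt
      by_contra! hholds
      exact hlt.not_subset (hmax ((satIn_iff hM').2 fun φ hφ I hI => hholds I hI φ hφ) hlt.subset)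

end PairSatisfaction

section Saturation

/-- `I` and `J` contain the same atoms with predicate symbols from `V`. -/
def AgreeOn (V : Set σ.Pred) (I J : Interp σ) : Prop :=
  ∀ p : GroundAtom σ, p.pred ∈ V → (p ∈ I ↔ p ∈ J)

/-- The interpretation that is `J` on the predicate symbols from `V` and `I` on the others. -/
def glue (V : Set σ.Pred) (J I : Interp σ) : Interp σ :=
  {p | (p.pred ∈ V ∧ p ∈ J) ∨ (p.pred ∉ V ∧ p ∈ I)}

variable {V W : Set σ.Pred} {M M' : Set (Interp σ)}

theorem AgreeOn.symm {I J : Interp σ} (h : AgreeOn V I J) : AgreeOn V J I :=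
  fun p hp => (h p hp).symm

theorem AgreeOn.trans {I J J' : Interp σ} (h : AgreeOn V I J) (h' : AgreeOn V J J') :
    AgreeOn V I J' :=
  fun p hp => (h p hp).trans (h' p hp)

theorem AgreeOn.sat_iff {n : ℕ} {φ : Formula σ n} {I J : Interp σ} (h : AgreeOn V I J)
    (hφ : φ.IsFirstOrder) (hV : φ.preds ⊆ V) (e : Fin n → σ.Const) (M N : Set (Interp σ)) :
    φ.Sat e I M N ↔ φ.Sat e J M N := by
  induction φ with
  | atom P t => exact h _ (hV rfl)
  | neg φ ih => exact not_congr (ih hφ hV e)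
  | conj φ ψ ih₁ ih₂ =>
    exact and_congr (ih₁ hφ.1 (Set.subset_union_left.trans hV) e)
      (ih₂ hφ.2 (Set.subset_union_right.trans hV) e)
  | ex φ ih => exact exists_congr fun c => ih hφ hV _
  | know => exact hφ.elim
  | mnot => exact hφ.elim

theorem agreeOn_glue (V : Set σ.Pred) (J I : Interp σ) : AgreeOn V J (glue V J I) := by
  intro p hp
  simp [glue, hp]

theorem agreeOn_glue_of_disjoint (h : Disjoint W V) (J I : Interp σ) :
    AgreeOn W I (glue V J I) := by
  intro p hp
  simp [glue, Set.disjoint_left.1 h hp]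

/-- The saturation of a set of interpretations with respect to `V`: the interpretations that agree
on `V` with one of its members. The closed sets are those that say nothing about the predicate
symbols outside `V`. -/
def saturate (V : Set σ.Pred) : ClosureOperator (Set (Interp σ)) :=
  ClosureOperator.mk' (fun M => {J | ∃ I ∈ M, AgreeOn V I J})
    (fun _ _ hM _ ⟨I, hI, hIJ⟩ => ⟨I, hM hI, hIJ⟩)
    (fun _ I hI => ⟨I, hI, fun _ _ => Iff.rfl⟩)
    (fun _ _ ⟨_, ⟨I, hI, hIJ⟩, hJJ'⟩ => ⟨I, hI, hIJ.trans hJJ'⟩)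

theorem subset_saturate (V : Set σ.Pred) (M : Set (Interp σ)) : M ⊆ saturate V M :=
  (saturate V).le_closure M

theorem isClosed_saturate_modelSet_fo {a : D.Ax} (ha : D.preds a ⊆ V) :
    (saturate V).IsClosed (modelSet {D.fo a}) := by
  refine (saturate V).isClosed_iff_closure_le.2 ?_
  rintro J ⟨I, hI, hIJ⟩
  rw [D.mem_modelSet_fo_iff ∅ ∅] at hI ⊢
  exact (hIJ.sat_iff (D.fo_isFirstOrder a) ha _ _ _).1 hI

theorem saturate_eq_of_subset_of_subset {Y : Set (Interp σ)} (hY : M ⊆ Y)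
    (hY' : Y ⊆ saturate V M) : saturate V Y = saturate V M :=
  ((saturate V).closure_min hY' ((saturate V).isClosed_closure M)).antisymm
    ((saturate V).monotone hY)

theorem Literal.satIn_saturate_iff {L : Literal σ} (hL : L.base.pred ∈ V) :
    L.SatIn (saturate V M') (saturate V M) ↔ L.SatIn M' M := by
  cases L with
  | pos p =>
    refine ⟨fun h J hJ => h J (subset_saturate V M' hJ), ?_⟩
    rintro h J ⟨I, hI, hIJ⟩
    exact (hIJ p hL).1 (h I hI)
  | dneg p =>
    constructor
    · rintro ⟨J, ⟨I, hI, hIJ⟩, hJ⟩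
      exact ⟨I, hI, mt (hIJ p hL).1 hJ⟩
    · rintro ⟨J, hJ, hp⟩
      exact ⟨J, subset_saturate V M hJ, hp⟩

theorem Literal.satIn_iff_of_subset_saturate {L : Literal σ} (hL : L.base.pred ∈ V)
    {Y : Set (Interp σ)} (hY : M ⊆ Y) (hY' : Y ⊆ saturate V M) : L.SatIn Y Y ↔ L.SatIn M M := by
  rw [← satIn_saturate_iff hL, saturate_eq_of_subset_of_subset hY hY', satIn_saturate_iff hL]

theorem Literal.SatIn.of_subset_saturate {L : Literal σ} (h : L.SatIn M M)
    (hL : L.base.pred ∈ V) (hM' : M' ⊆ saturate V M) : L.SatIn M' M := by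
  have hsat : L.SatIn (saturate V M) M := by
    cases L with
    | pos p => exact (satIn_saturate_iff hL).2 h
    | dneg p => exact h
  exact hsat.anti hM'

theorem litPreds_subset_iff {B : Set (Literal σ)} :
    litPreds B ⊆ V ↔ ∀ L ∈ B, L.base.pred ∈ V := by
  simp only [litPreds, Literal.preds, Set.iUnion_subset_iff, Set.singleton_subset_iff]

theorem Rule.preds_subset_iff {r : Rule σ} :
    r.preds ⊆ V ↔ r.head.base.pred ∈ V ∧ ∀ L ∈ r.body, L.base.pred ∈ V := by
  rw [Rule.preds, Set.union_subset_iff, litPreds_subset_iff, Literal.preds,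
    Set.singleton_subset_iff]

theorem Rule.satIn_saturate_iff {r : Rule σ} (hr : r.preds ⊆ V) :
    r.SatIn (saturate V M') (saturate V M) ↔ r.SatIn M' M := by
  obtain ⟨hhead, hbody⟩ := Rule.preds_subset_iff.1 hr
  exact imp_congr (forall₂_congr fun L hL => Literal.satIn_saturate_iff (hbody L hL))
    (Literal.satIn_saturate_iff hhead)

/-- All predicate symbols of `K` are in `V`. -/
def HybridKB.PredsIn (K : HybridKB D) (V : Set σ.Pred) : Prop :=
  (∀ a ∈ K.ont, D.preds a ⊆ V) ∧ ∀ r ∈ K.prog, r.preds ⊆ V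

variable {K : HybridKB D}

theorem HybridKB.PredsIn.satIn_saturate_iff (hK : K.PredsIn V) :
    K.SatIn (saturate V M') (saturate V M) ↔ K.SatIn M' M :=
  and_congr
    (forall₂_congr fun a ha => (isClosed_saturate_modelSet_fo (hK.1 a ha)).closure_le_iff)
    (forall₂_congr fun r hr => Rule.satIn_saturate_iff (hK.2 r hr))

theorem HybridKB.PredsIn.satIn_congr (hK : K.PredsIn V) {N N' : Set (Interp σ)}
    (h' : saturate V M' = saturate V N') (h : saturate V M = saturate V N) :
    K.SatIn M' M ↔ K.SatIn N' N := by
  rw [← hK.satIn_saturate_iff, h', h, hK.satIn_saturate_iff]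

theorem HybridKB.IsModel.isClosed_saturate (hM : K.IsModel M) (hK : K.PredsIn V) :
    (saturate V).IsClosed M := by
  obtain ⟨-, hmax⟩ := isModel_iff.1 hM
  have hsat : K.SatIn (saturate V M) M :=
    (hK.satIn_congr ((saturate V).idempotent M) rfl).2 hmax.prop
  exact (saturate V).isClosed_iff_closure_le.2 (hmax.le_of_ge hsat (subset_saturate V M))

theorem Formula.preds_nonempty {n : ℕ} (φ : Formula σ n) : φ.preds.Nonempty := by
  induction φ with
  | atom P t => exact ⟨P, rfl⟩
  | neg _ ih => exact ih
  | conj _ _ ih _ => exact ih.inl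
  | ex _ ih => exact ih
  | know _ ih => exact ih
  | mnot _ ih => exact ih

theorem HybridKB.isModel_iff_eq_univ_of_predsIn_empty (hK : K.PredsIn ∅) :
    K.IsModel M ↔ M = Set.univ := by
  have hsat (M' : Set (Interp σ)) : K.SatIn M' M :=
    ⟨fun a ha => ((D.fo a).preds_nonempty.not_subset_empty (hK.1 a ha)).elim,
      fun r hr => (Rule.preds_subset_iff.1 (hK.2 r hr)).1.elim⟩
  rw [isModel_iff]
  constructor
  · rintro ⟨-, hmax⟩
    exact Set.univ_subset_iff.1 (hmax.le_of_ge (hsat _) (Set.subset_univ M))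
  · rintro rfl
    exact ⟨Set.univ_nonempty, hsat _, fun M' _ _ => Set.subset_univ M'⟩

variable {ι : Type*} {rank : σ.Pred → ι} {X : ι → Set (Interp σ)}

theorem saturate_iInter (hX : ∀ α, (saturate (rank ⁻¹' {α})).IsClosed (X α))
    (hne : (⋂ α, X α).Nonempty) (α : ι) : saturate (rank ⁻¹' {α}) (⋂ α, X α) = X α := by
  refine ((saturate _).closure_min (Set.iInter_subset X α) (hX α)).antisymm fun J hJ => ?_
  obtain ⟨I, hI⟩ := hne
  have mem_of_agreeOn {β : ι} {I' J' : Interp σ} (hI' : I' ∈ X β)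
      (h : AgreeOn (rank ⁻¹' {β}) I' J') : J' ∈ X β :=
    (saturate _).isClosed_iff_closure_le.1 (hX β) ⟨I', hI', h⟩
  refine ⟨glue (rank ⁻¹' {α}) J I, Set.mem_iInter.2 fun β => ?_, (agreeOn_glue _ J I).symm⟩
  obtain rfl | hβ := eq_or_ne β α
  · exact mem_of_agreeOn hJ (agreeOn_glue _ J I)
  · exact mem_of_agreeOn (Set.mem_iInter.1 hI β)
      (agreeOn_glue_of_disjoint (Disjoint.preimage rank (by simpa using hβ)) J I)

end Saturation

section SplittingSets

variable {K : HybridKB D} {U : Set σ.Pred} {X Y M' M : Set (Interp σ)}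

theorem HybridKB.IsSplittingSet.preds_subset_iff (hU : K.IsSplittingSet U) {r : Rule σ}
    (hr : r ∈ K.prog) : r.preds ⊆ U ↔ r.head.base.pred ∈ U :=
  ⟨fun h => (Rule.preds_subset_iff.1 h).1, fun h => hU.2 r hr ⟨_, rfl, h⟩⟩

theorem entails_trans_image_iff (hX : X.Nonempty) {B : Set (Literal σ)} :
    Entails X (Literal.trans '' B) ↔ ∀ L ∈ B, L.SatIn X X := by
  obtain ⟨I₀, hI₀⟩ := hX
  constructor
  · exact fun h L hL => (L.holds_trans I₀ X X).1 (h _ (Set.mem_image_of_mem _ hL) I₀ hI₀)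
  · rintro h _ ⟨L, hL, rfl⟩ I _
    exact (L.holds_trans I X X).2 (h L hL)

theorem HybridKB.reduct_congr (hX : X.Nonempty) (hY : Y.Nonempty)
    (h : ∀ L : Literal σ, L.base.pred ∈ U → (L.SatIn X X ↔ L.SatIn Y Y)) :
    K.reduct U X = K.reduct U Y := by
  have entails_iff (r : Rule σ) : Entails X (Literal.trans '' {L ∈ r.body | L.preds ⊆ U}) ↔
      Entails Y (Literal.trans '' {L ∈ r.body | L.preds ⊆ U}) := by
    rw [entails_trans_image_iff hX, entails_trans_image_iff hY]
    exact forall₂_congr fun L hL => h L (hL.2 rfl)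
  simp only [reduct, entails_iff]

theorem HybridKB.satIn_reduct_iff (hX : X.Nonempty) :
    (K.reduct U X).SatIn M' M ↔ (∀ a ∈ (K.top U).ont, M' ⊆ modelSet {D.fo a}) ∧
      ∀ r ∈ (K.top U).prog, (∀ L ∈ r.body, L.base.pred ∈ U → L.SatIn X X) →
        (∀ L ∈ r.body, L.base.pred ∉ U → L.SatIn M' M) → r.head.SatIn M' M := by
  classical
  refine and_congr_right fun _ => ⟨fun h r hr hlow hrest => ?_, ?_⟩
  · let r' : Rule σ := ⟨r.head, r.bodyList.filter fun L => L.base.pred ∉ U⟩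
    have mem_body_iff {L : Literal σ} : L ∈ r'.body ↔ L ∈ r.body ∧ L.base.pred ∉ U := by
      simp [r', Rule.body]
    refine h r' ⟨r, hr, ?_, rfl, ?_⟩ fun L hL => hrest L (mem_body_iff.1 hL).1 (mem_body_iff.1 hL).2
    · exact (entails_trans_image_iff hX).2 fun L hL => hlow L hL.1 (hL.2 rfl)
    · ext L
      simp [mem_body_iff, Literal.preds]
  · rintro h r' ⟨r, hr, hlow, hhead, hbody⟩ hrest
    rw [entails_trans_image_iff hX] at hlow
    rw [hhead]
    refine h r hr (fun L hL hLU => hlow L ⟨hL, Set.singleton_subset_iff.2 hLU⟩) fun L hL hLU => ?_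
    exact hrest L (hbody ▸ ⟨hL, Set.singleton_subset_iff.2 hLU⟩)

end SplittingSets

section Stratification

variable {ι : Type*} [PartialOrder ι] {rank : σ.Pred → ι} {K : HybridKB D} {α : ι}
  {X M' M : Set (Interp σ)}

/-- `K` is stratified by `rank` if the predicate symbols up to any given rank form a splitting
set. -/
def HybridKB.IsStratified (K : HybridKB D) (rank : σ.Pred → ι) : Prop :=
  ∀ α, K.IsSplittingSet (rank ⁻¹' Set.Iic α)

/-- The layer of rank `α`: the part of `K` of rank `α`, simplified by evaluating in `X` the body
literals of lower rank. -/
def HybridKB.layer (rank : σ.Pred → ι) (X : Set (Interp σ)) (α : ι) (K : HybridKB D) :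
    HybridKB D :=
  (K.bottom (rank ⁻¹' Set.Iic α)).reduct (rank ⁻¹' Set.Iio α) X

theorem HybridKB.IsStratified.exists_preds_subset (hK : K.IsStratified rank) {a : D.Ax}
    (ha : a ∈ K.ont) : ∃ α, D.preds a ⊆ rank ⁻¹' {α} := by
  obtain ⟨P, hP⟩ := (D.fo a).preds_nonempty
  have rank_le {Q R : σ.Pred} (hQ : Q ∈ D.preds a) (hR : R ∈ D.preds a) : rank Q ≤ rank R :=
    (hK (rank R)).1 a ha ⟨R, hR, le_rfl⟩ hQ
  exact ⟨rank P, fun Q hQ => (rank_le hQ hP).antisymm (rank_le hP hQ)⟩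

theorem HybridKB.IsStratified.rank_le (hK : K.IsStratified rank) {r : Rule σ} (hr : r ∈ K.prog)
    {L : Literal σ} (hL : L ∈ r.body) : rank L.base.pred ≤ rank r.head.base.pred :=
  (Rule.preds_subset_iff.1 (((hK _).preds_subset_iff hr).2 le_rfl)).2 L hL

theorem HybridKB.IsStratified.mem_top_bottom_ont_iff (hK : K.IsStratified rank) {a : D.Ax} :
    a ∈ ((K.bottom (rank ⁻¹' Set.Iic α)).top (rank ⁻¹' Set.Iio α)).ont ↔
      a ∈ K.ont ∧ D.preds a ⊆ rank ⁻¹' {α} := by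
  obtain ⟨P, hP⟩ := (D.fo a).preds_nonempty
  constructor
  · rintro ⟨⟨ha, hle⟩, hlt⟩
    obtain ⟨β, hβ⟩ := hK.exists_preds_subset ha
    have hβα : β = α := by
      refine (hβ hP ▸ hle hP : β ≤ α).eq_of_not_lt fun hβα => hlt ⟨⟨ha, hle⟩, fun Q hQ => ?_⟩
      exact (hβ hQ).trans_lt hβα
    exact ⟨ha, hβα ▸ hβ⟩
  · rintro ⟨ha, hα⟩
    refine ⟨⟨ha, fun Q hQ => (hα hQ).le⟩, fun hlt => (hlt.2 hP).ne (hα hP)⟩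

theorem HybridKB.IsStratified.mem_top_bottom_prog_iff (hK : K.IsStratified rank) {r : Rule σ} :
    r ∈ ((K.bottom (rank ⁻¹' Set.Iic α)).top (rank ⁻¹' Set.Iio α)).prog ↔
      r ∈ K.prog ∧ rank r.head.base.pred = α := by
  constructor
  · rintro ⟨⟨hr, hle⟩, hlt⟩
    refine ⟨hr, (Rule.preds_subset_iff.1 hle).1.eq_of_not_lt fun h => hlt ⟨⟨hr, hle⟩, ?_⟩⟩
    exact Rule.preds_subset_iff.2 ⟨h, fun L hL => (hK.rank_le hr hL).trans_lt h⟩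
  · rintro ⟨hr, rfl⟩
    exact ⟨⟨hr, ((hK _).preds_subset_iff hr).2 le_rfl⟩,
      fun h => (Rule.preds_subset_iff.1 h.2).1.ne rfl⟩

theorem HybridKB.IsStratified.predsIn_layer (hK : K.IsStratified rank) :
    (K.layer rank X α).PredsIn (rank ⁻¹' {α}) := by
  refine ⟨fun a ha => (hK.mem_top_bottom_ont_iff.1 ha).2, ?_⟩
  rintro r' ⟨r, hr, -, hhead, hbody⟩
  obtain ⟨hrK, rfl⟩ := hK.mem_top_bottom_prog_iff.1 hr
  refine Rule.preds_subset_iff.2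
    ⟨congrArg (fun L : Literal σ => rank L.base.pred) hhead, fun L hL => ?_⟩
  rw [hbody] at hL
  exact (hK.rank_le hrK hL.1).eq_of_not_lt (hL.2 rfl)

theorem HybridKB.IsStratified.satIn_layer_iff (hK : K.IsStratified rank) (hX : X.Nonempty) :
    (K.layer rank X α).SatIn M' M ↔
      (∀ a ∈ K.ont, D.preds a ⊆ rank ⁻¹' {α} → M' ⊆ modelSet {D.fo a}) ∧
      ∀ r ∈ K.prog, rank r.head.base.pred = α →
        (∀ L ∈ r.body, rank L.base.pred < α → L.SatIn X X) →
        (∀ L ∈ r.body, rank L.base.pred = α → L.SatIn M' M) → r.head.SatIn M' M := by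
  rw [layer, satIn_reduct_iff hX]
  simp only [hK.mem_top_bottom_ont_iff, hK.mem_top_bottom_prog_iff, and_imp]
  refine and_congr_right fun _ => forall₃_congr fun r hr hα => imp_congr_right fun _ =>
    imp_congr_left (forall₂_congr fun L hL => imp_congr_left ?_)
  have hle : rank L.base.pred ≤ α := hα ▸ hK.rank_le hr hL
  exact ⟨hle.eq_of_not_lt, fun h => h.not_lt⟩

theorem HybridKB.IsStratified.satIn_of_satIn_layer (hK : K.IsStratified rank) (hM : M.Nonempty)
    (hMM' : M ⊆ M') (h : ∀ α, (K.layer rank M α).SatIn M' M) : K.SatIn M' M := by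
  constructor
  · intro a ha
    obtain ⟨α, hα⟩ := hK.exists_preds_subset ha
    exact ((hK.satIn_layer_iff hM).1 (h α)).1 a ha hα
  · intro r hr hbody
    exact ((hK.satIn_layer_iff hM).1 (h _)).2 r hr rfl (fun L hL _ => (hbody L hL).anti hMM')
      fun L hL _ => hbody L hL

theorem HybridKB.IsStratified.satIn_layer (hK : K.IsStratified rank) (hM : M.Nonempty)
    (h : K.SatIn M' M) (hlow : ∀ β < α, M' ⊆ saturate (rank ⁻¹' {β}) M) :
    (K.layer rank M α).SatIn M' M := by
  refine (hK.satIn_layer_iff hM).2 ⟨fun a ha _ => h.1 a ha, ?_⟩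
  rintro r hr rfl hlt heq
  refine h.2 r hr fun L hL => ?_
  obtain hrank | hrank := (hK.rank_le hr hL).lt_or_eq
  · exact (hlt L hL hrank).of_subset_saturate (V := rank ⁻¹' {_}) rfl (hlow _ hrank)
  · exact heq L hL hrank

theorem HybridKB.layer_iInter_saturate (hM : M.Nonempty) :
    K.layer rank (⋂ β < α, saturate (rank ⁻¹' {β}) M) α = K.layer rank M α := by
  have hsub : M ⊆ ⋂ β < α, saturate (rank ⁻¹' {β}) M :=
    Set.subset_iInter₂ fun β _ => subset_saturate _ M
  refine reduct_congr (hM.mono hsub) hM fun L hL => ?_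
  have hsub' : ⋂ β < α, saturate (rank ⁻¹' {β}) M ⊆ saturate (rank ⁻¹' {rank L.base.pred}) M :=
    Set.iInter₂_subset (rank L.base.pred) hL
  exact Literal.satIn_iff_of_subset_saturate (V := rank ⁻¹' {rank L.base.pred}) rfl hsub hsub'

theorem HybridKB.IsModel.satIn_layer (hM : K.IsModel M) (hK : K.IsStratified rank) (α : ι) :
    (K.layer rank M α).SatIn M M := by
  obtain ⟨hne, hmax⟩ := isModel_iff.1 hM
  exact hK.satIn_layer hne hmax.prop fun β _ => subset_saturate _ M

theorem HybridKB.IsModel.iInter_saturate (hM : K.IsModel M) (hK : K.IsStratified rank) :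
    ⋂ α, saturate (rank ⁻¹' {α}) M = M := by
  obtain ⟨hne, hmax⟩ := isModel_iff.1 hM
  have hsub : M ⊆ ⋂ α, saturate (rank ⁻¹' {α}) M := Set.subset_iInter fun α => subset_saturate _ M
  refine (hmax.le_of_ge (hK.satIn_of_satIn_layer hne hsub fun α => ?_) hsub).antisymm hsub
  exact (hK.predsIn_layer.satIn_congr
    (saturate_eq_of_subset_of_subset hsub (Set.iInter_subset _ α)) rfl).2 (hM.satIn_layer hK α)

theorem HybridKB.IsModel.isModel_layer (hM : K.IsModel M) (hK : K.IsStratified rank) (α : ι) :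
    (K.layer rank M α).IsModel (saturate (rank ⁻¹' {α}) M) := by
  classical
  obtain ⟨hne, hmax⟩ := isModel_iff.1 hM
  refine isModel_iff.2 ⟨hne.mono (subset_saturate _ M),
    hK.predsIn_layer.satIn_saturate_iff.2 (hM.satIn_layer hK α), fun N hN hMN => ?_⟩
  let X : ι → Set (Interp σ) :=
    Function.update (fun β => saturate (rank ⁻¹' {β}) M) α (saturate (rank ⁻¹' {α}) N)
  have hXα : X α = saturate (rank ⁻¹' {α}) N := Function.update_self ..
  have hX (β : ι) (hβ : β ≠ α) : X β = saturate (rank ⁻¹' {β}) M := Function.update_of_ne hβ ..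
  have hMX : M ⊆ ⋂ β, X β := by
    refine Set.subset_iInter fun β => ?_
    obtain rfl | hβ := eq_or_ne β α
    · exact hXα ▸ (subset_saturate _ M).trans (hMN.trans (subset_saturate _ N))
    · exact hX β hβ ▸ subset_saturate _ M
  have hsat (β : ι) : saturate (rank ⁻¹' {β}) (⋂ β, X β) = X β := by
    refine saturate_iInter (fun β => ?_) (hne.mono hMX) β
    obtain rfl | hβ := eq_or_ne β α
    exacts [hXα ▸ (saturate _).isClosed_closure N, hX β hβ ▸ (saturate _).isClosed_closure M]
  have hXM : K.SatIn (⋂ β, X β) M := by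
    refine hK.satIn_of_satIn_layer hne hMX fun β => ?_
    obtain rfl | hβ := eq_or_ne β α
    · exact (hK.predsIn_layer.satIn_congr ((hsat β).trans hXα)
        ((saturate _).idempotent M).symm).2 hN
    · exact (hK.predsIn_layer.satIn_congr ((hsat β).trans (hX β hβ)) rfl).2 (hM.satIn_layer hK β)
  calc N ⊆ saturate (rank ⁻¹' {α}) N := subset_saturate _ N
    _ = saturate (rank ⁻¹' {α}) (⋂ β, X β) := by rw [hsat, hXα]
    _ ⊆ saturate (rank ⁻¹' {α}) M := (saturate _).monotone (hmax.le_of_ge hXM hMX)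

theorem HybridKB.IsStratified.isModel_of_isModel_layer [WellFoundedLT ι]
    (hK : K.IsStratified rank) (hM : M.Nonempty) (hsat : ⋂ α, saturate (rank ⁻¹' {α}) M = M)
    (hlayer : ∀ α, (K.layer rank M α).IsModel (saturate (rank ⁻¹' {α}) M)) : K.IsModel M := by
  have hmax (α : ι) := (isModel_iff.1 (hlayer α)).2
  refine isModel_iff.2 ⟨hM, hK.satIn_of_satIn_layer hM subset_rfl fun α =>
    hK.predsIn_layer.satIn_saturate_iff.1 (hmax α).prop, fun M' hM' hMM' => ?_⟩
  have hM'α (α : ι) : M' ⊆ saturate (rank ⁻¹' {α}) M := by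
    induction α using WellFoundedLT.induction with
    | ind α ih =>
      have hlayerM' := hK.predsIn_layer.satIn_saturate_iff.2 (hK.satIn_layer hM hM' ih)
      exact (subset_saturate _ M').trans
        ((hmax α).le_of_ge hlayerM' ((saturate _).monotone hMM'))
  exact (Set.subset_iInter hM'α).trans hsat.subset

theorem HybridKB.IsStratified.isModel_iff [WellFoundedLT ι] (hK : K.IsStratified rank)
    (hM : M.Nonempty) :
    K.IsModel M ↔ ∃ X : ι → Set (Interp σ),
      (∀ α, (K.layer rank (⋂ η < α, X η) α).IsModel (X α)) ∧ M = ⋂ α, X α := by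
  constructor
  · intro hmodel
    refine ⟨fun α => saturate (rank ⁻¹' {α}) M, fun α => ?_, (hmodel.iInter_saturate hK).symm⟩
    rw [layer_iInter_saturate hM]
    exact hmodel.isModel_layer hK α
  · rintro ⟨X, hX, rfl⟩
    have hsat := saturate_iInter (fun α => (hX α).isClosed_saturate hK.predsIn_layer) hM
    refine hK.isModel_of_isModel_layer hM (Set.iInter_congr hsat) fun α => ?_
    rw [← layer_iInter_saturate hM]
    simpa only [hsat] using hX α

end Stratification

section OntologyBased

variable {K : HybridKB D} {M M' : Set (Interp σ)}

theorem mem_predDiff {P : σ.Pred} {I J : Interp σ} {p : GroundAtom σ} :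
    p ∈ predDiff P I J ↔ p.pred = P ∧ ¬ (p ∈ I ↔ p ∈ J) := by
  simp only [predDiff, restrictPred, Set.mem_union, Set.mem_sdiff, Set.mem_ofPred_eq]
  tauto

theorem closerEq_self (I J : Interp σ) : CloserEq I I J :=
  fun _ _ hp => ((mem_predDiff.1 hp).2 Iff.rfl).elim

theorem update_univ (N : Set (Interp σ)) : update Set.univ N = N := by
  refine (Set.iUnion₂_subset fun I _ => Set.sep_subset _ _).antisymm fun J hJ => ?_
  exact Set.mem_iUnion₂.2 ⟨J, Set.mem_univ J, hJ, fun ⟨J', _, h⟩ => h.2 (closerEq_self J J')⟩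

theorem minimalChange_singleton (T : Set (Sentence σ)) : minimalChange [T] = modelSet T :=
  update_univ _

theorem Rule.IsFact.body_eq {r : Rule σ} (h : r.IsFact) : r.body = ∅ :=
  Set.eq_empty_iff_forall_notMem.2 fun _ => List.eq_nil_iff_forall_not_mem.1 h _

namespace HybridKB

theorem isFirstOrder_of_mem_foTheory {φ : Sentence σ} (hφ : φ ∈ K.foTheory) :
    Formula.IsFirstOrder φ := by
  obtain ⟨a, -, rfl⟩ | ⟨r, -, p, -, -, rfl⟩ := hφ
  · exact D.fo_isFirstOrder a
  · trivial

theorem OntBased.satIn_iff (hK : K.OntBased) : K.SatIn M' M ↔ M' ⊆ modelSet K.foTheory := by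
  have mem_iff (I : Interp σ) := mem_modelSet_iff (T := K.foTheory) (I := I)
    (fun _ => isFirstOrder_of_mem_foTheory) M' M
  constructor
  · rintro ⟨hont, hprog⟩ I hI
    rw [mem_iff]
    rintro φ (⟨a, ha, rfl⟩ | ⟨r, hr, p, hp, hfact, rfl⟩)
    · exact (D.mem_modelSet_fo_iff M' M).1 (hont a ha hI)
    · have hhead : r.head.SatIn M' M := hprog r hr (by simp [hfact.body_eq])
      rw [hp] at hhead
      exact hhead I hI
  · intro h
    refine ⟨fun a ha I hI => ?_, fun r hr _ => ?_⟩
    · exact (D.mem_modelSet_fo_iff M' M).2 ((mem_iff I).1 (h hI) _ (.inl ⟨a, ha, rfl⟩))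
    · obtain ⟨⟨p, hp⟩, hfact⟩ := hK r hr
      rw [hp]
      exact fun I hI => (mem_iff I).1 (h hI) _ (.inr ⟨r, hr, p, hp, hfact, rfl⟩)

theorem OntBased.isModel_iff (hK : K.OntBased) :
    K.IsModel M ↔ M.Nonempty ∧ M = minimalChange [K.foTheory] := by
  simp only [HybridKB.isModel_iff, hK.satIn_iff, minimalChange_singleton, maximal_le_iff]

end HybridKB

end OntologyBased

section ProgramBased

variable {P : Program σ} {I J : Interp σ} {S : Set (Literal σ)}

/-- `S` is a model of `P` when every literal, be it an atom or a default literal, is read as an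
atom of its own. -/
def ClosedUnder (P : Program σ) (S : Set (Literal σ)) : Prop :=
  ∀ r ∈ P, r.body ⊆ S → r.head ∈ S

/-- The literals that are true when atoms are evaluated in `J` and default literals in `I`. -/
def mixedInterp (J I : Interp σ) : Set (Literal σ) :=
  Literal.pos '' J ∪ Literal.dneg '' Iᶜ

/-- `I` is a stable model of `P`: a minimal model of the reduct of `P` by `I`, where rules with a
default literal as their head become constraints. -/
def IsStable (P : Program σ) (I : Interp σ) : Prop :=
  Minimal (fun J => ClosedUnder P (mixedInterp J I)) I

theorem pos_mem_mixedInterp {p : GroundAtom σ} : .pos p ∈ mixedInterp J I ↔ p ∈ J := by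
  simp [mixedInterp]

theorem dneg_mem_mixedInterp {p : GroundAtom σ} : .dneg p ∈ mixedInterp J I ↔ p ∉ I := by
  simp [mixedInterp]

theorem mixedInterp_mono {J' : Interp σ} (h : J ⊆ J') : mixedInterp J I ⊆ mixedInterp J' I :=
  Set.union_subset_union_left _ (Set.image_mono h)

theorem mixedInterp_self (I : Interp σ) : mixedInterp I I = extendInterp I := by
  ext L
  cases L with
  | pos p => exact pos_mem_mixedInterp
  | dneg p => exact dneg_mem_mixedInterp

theorem Literal.satIn_iff_mem_mixedInterp {L : Literal σ} {M' M : Set (Interp σ)} :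
    L.SatIn M' M ↔ L ∈ mixedInterp (⋂₀ M') (⋂₀ M) := by
  cases L with
  | pos p => exact Set.mem_sInter.symm.trans pos_mem_mixedInterp.symm
  | dneg p => simp [Literal.SatIn, dneg_mem_mixedInterp]

theorem HybridKB.ProgBased.satIn_iff {K : HybridKB D} (hK : K.ProgBased) {M' M : Set (Interp σ)} :
    K.SatIn M' M ↔ ClosedUnder K.prog (mixedInterp (⋂₀ M') (⋂₀ M)) := by
  have hont : K.ont = ∅ := hK
  simp only [HybridKB.SatIn, hont, Rule.SatIn, Literal.satIn_iff_mem_mixedInterp]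
  exact and_iff_right fun a ha => ha.elim

theorem sInter_setOf_superset (I : Interp σ) : ⋂₀ {J | I ⊆ J} = I :=
  csInf_Ici

theorem HybridKB.ProgBased.isModel_iff_isStable {K : HybridKB D} (hK : K.ProgBased)
    {M : Set (Interp σ)} : K.IsModel M ↔ ∃ I, IsStable K.prog I ∧ M = {J | I ⊆ J} := by
  simp only [HybridKB.isModel_iff, hK.satIn_iff]
  constructor
  · rintro ⟨-, hmax⟩
    have hsub : M ⊆ {J | ⋂₀ M ⊆ J} := fun J hJ => Set.sInter_subset_of_mem hJ
    have supersets_subset {J : Interp σ} (hJ : J ⊆ ⋂₀ M)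
        (hclosed : ClosedUnder K.prog (mixedInterp J (⋂₀ M))) : {J' | J ⊆ J'} ⊆ M :=
      hmax.le_of_ge (by rwa [sInter_setOf_superset]) fun J' hJ' => hJ.trans (hsub hJ')
    refine ⟨⋂₀ M, ⟨hmax.prop, fun J hclosed hJ => ?_⟩,
      hsub.antisymm (supersets_subset subset_rfl hmax.prop)⟩
    exact Set.sInter_subset_of_mem (supersets_subset hJ hclosed (Set.Subset.refl J))
  · rintro ⟨I, hI, rfl⟩
    rw [sInter_setOf_superset]
    refine ⟨⟨I, Set.Subset.refl I⟩, by simpa only [sInter_setOf_superset] using hI.prop,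
      fun M' hclosed hM' J hJ => ?_⟩
    have hle : ⋂₀ M' ⊆ I := Set.sInter_subset_of_mem (hM' (Set.Subset.refl I))
    exact (hI.le_of_le hclosed hle).trans (Set.sInter_subset_of_mem hJ)

theorem ClosedUnder.leastModel_subset (h : ClosedUnder P S) : leastModel P ⊆ S :=
  Set.sInter_subset_of_mem h

theorem closedUnder_leastModel (P : Program σ) : ClosedUnder P (leastModel P) :=
  fun r hr hbody _ hS => hS r hr (hbody.trans (ClosedUnder.leastModel_subset hS))

theorem exists_rule_of_mem_leastModel {L : Literal σ} (hL : L ∈ leastModel P) :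
    ∃ r ∈ P, r.head = L := by
  by_contra! hne
  have hclosed : ClosedUnder P {L}ᶜ := fun r hr _ => hne r hr
  exact hclosed.leastModel_subset hL rfl

theorem Literal.compl_mem_extendInterp_iff {L : Literal σ} :
    L.compl ∈ extendInterp I ↔ L ∉ extendInterp I := by
  cases L with
  | pos p => exact Iff.rfl
  | dneg p => exact not_not.symm

theorem IsStable.closedUnder_extendInterp (h : IsStable P I) : ClosedUnder P (extendInterp I) :=
  mixedInterp_self I ▸ h.prop

theorem IsStable.exists_rule_of_mem (h : IsStable P I) {p : GroundAtom σ} (hp : p ∈ I) :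
    ∃ r ∈ P, r.head = .pos p ∧ SatBody I r.body := by
  by_contra! hne
  have hclosed : ClosedUnder P (mixedInterp (I \ {p}) I) := by
    intro r hr hbody
    have hbodyI : SatBody I r.body := by
      have := hbody.trans (mixedInterp_mono Set.sdiff_subset)
      rwa [mixedInterp_self] at this
    have hhead := h.closedUnder_extendInterp r hr hbodyI
    cases hL : r.head with rw [hL] at hhead
    | pos q => exact pos_mem_mixedInterp.2 ⟨hhead, fun hqp => hne r hr (hqp ▸ hL) hbodyI⟩
    | dneg q => exact dneg_mem_mixedInterp.2 hhead
  exact (h.le_of_le hclosed Set.sdiff_subset hp).2 rfl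

theorem mem_survivingRules_singleton {r : Rule σ} : r ∈ survivingRules [P] I ↔
    r ∈ P ∧ ¬ ∃ r' ∈ P, r.Conflicts r' ∧ SatBody I r'.body := by
  have isRejected_iff (i : Fin [P].length) :
      IsRejected [P] I i r ↔ ∃ r' ∈ P, r.Conflicts r' ∧ SatBody I r'.body := by
    obtain rfl : i = (0 : Fin 1) := Subsingleton.elim (α := Fin 1) _ _
    exact Fin.exists_fin_one.trans (and_iff_right le_rfl)
  exact Fin.exists_fin_one.trans (and_congr_right fun _ => not_congr (isRejected_iff (0 : Fin 1)))

theorem mem_defaultFacts_singleton {r : Rule σ} : r ∈ defaultFacts [P] I ↔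
    r.IsFact ∧ ∃ p, r.head = .dneg p ∧ ¬ ∃ r' ∈ P, r'.head = .pos p ∧ SatBody I r'.body :=
  and_congr_right fun _ => exists_congr fun _ => and_congr_right fun _ =>
    not_congr Fin.exists_fin_one

/-- A derivation of the complementary literal would have to end with a rule that is rejected, or
with a default assumption that is blocked, by the given rule. -/
theorem compl_head_notMem_leastModel {r : Rule σ} (hr : r ∈ P) (hbody : SatBody I r.body) :
    r.head.compl ∉ leastModel (survivingRules [P] I ∪ defaultFacts [P] I) := by
  intro hmem
  obtain ⟨s, hs | hs, hhead⟩ := exists_rule_of_mem_leastModel hmem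
  · exact (mem_survivingRules_singleton.1 hs).2 ⟨r, hr, hhead, hbody⟩
  · obtain ⟨-, p, hp, hblocked⟩ := mem_defaultFacts_singleton.1 hs
    refine hblocked ⟨r, hr, ?_, hbody⟩
    cases hL : r.head <;> simp_all [Literal.compl]

theorem IsDynamicStableModel.isStable (h : IsDynamicStableModel [P] I) : IsStable P I := by
  have hclosed : ClosedUnder P (extendInterp I) := fun r hr hbody => by
    by_contra hhead
    rw [← Literal.compl_mem_extendInterp_iff, h] at hhead
    exact compl_head_notMem_leastModel hr hbody hhead
  have dneg_mem {J : Interp σ} {s : Rule σ} (hs : s ∈ defaultFacts [P] I) :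
      s.head ∈ mixedInterp J I := by
    have hhead : s.head ∈ extendInterp I := by
      rw [h]
      refine closedUnder_leastModel _ s (.inr hs) ?_
      simp [(mem_defaultFacts_singleton.1 hs).1.body_eq]
    obtain ⟨-, p, hp, -⟩ := mem_defaultFacts_singleton.1 hs
    rw [hp] at hhead ⊢
    exact dneg_mem_mixedInterp.2 hhead
  refine ⟨by rwa [← mixedInterp_self] at hclosed, fun J hJ _ p hp => ?_⟩
  have hclosedJ : ClosedUnder (survivingRules [P] I ∪ defaultFacts [P] I) (mixedInterp J I) := by
    rintro s (hs | hs) hbody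
    exacts [hJ s (mem_survivingRules_singleton.1 hs).1 hbody, dneg_mem hs]
  have hpos : .pos p ∈ extendInterp I := hp
  rw [h] at hpos
  exact pos_mem_mixedInterp.1 (hclosedJ.leastModel_subset hpos)

theorem IsStable.leastModel_subset_extendInterp (h : IsStable P I) :
    leastModel (survivingRules [P] I ∪ defaultFacts [P] I) ⊆ extendInterp I := by
  refine ClosedUnder.leastModel_subset ?_
  rintro s (hs | hs) hbody
  · exact h.closedUnder_extendInterp s (mem_survivingRules_singleton.1 hs).1 hbody
  · obtain ⟨-, p, hp, hblocked⟩ := mem_defaultFacts_singleton.1 hs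
    rw [hp]
    exact mt h.exists_rule_of_mem hblocked

theorem IsStable.dneg_mem_leastModel (h : IsStable P I) {p : GroundAtom σ} (hp : p ∉ I) :
    .dneg p ∈ leastModel (survivingRules [P] I ∪ defaultFacts [P] I) := by
  have hfact : (⟨.dneg p, []⟩ : Rule σ) ∈ defaultFacts [P] I := by
    refine mem_defaultFacts_singleton.2 ⟨rfl, p, rfl, ?_⟩
    rintro ⟨r, hr, hhead, hbody⟩
    have := h.closedUnder_extendInterp r hr hbody
    rw [hhead] at this
    exact hp this
  exact closedUnder_leastModel _ ⟨.dneg p, []⟩ (.inr hfact) fun _ hL =>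
    (List.not_mem_nil hL).elim

theorem IsStable.closedUnder_leastModel_survivingRules (h : IsStable P I) :
    ClosedUnder P (leastModel (survivingRules [P] I ∪ defaultFacts [P] I)) := by
  intro r hr hbody
  have hhead := h.closedUnder_extendInterp r hr (hbody.trans h.leastModel_subset_extendInterp)
  refine closedUnder_leastModel _ r
    (.inl (mem_survivingRules_singleton.2 ⟨hr, ?_⟩)) hbody
  rintro ⟨r', hr', hconflict, hbody'⟩
  rw [show r.head = r'.head.compl from hconflict, Literal.compl_mem_extendInterp_iff] at hhead
  exact hhead (h.closedUnder_extendInterp r' hr' hbody')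

theorem IsStable.isDynamicStableModel (h : IsStable P I) : IsDynamicStableModel [P] I := by
  set lm := leastModel (survivingRules [P] I ∪ defaultFacts [P] I)
  have hle : lm ⊆ extendInterp I := h.leastModel_subset_extendInterp
  have mixedInterp_eq : mixedInterp {p | .pos p ∈ lm} I = lm := by
    ext L
    cases L with
    | pos p => exact pos_mem_mixedInterp
    | dneg p => exact dneg_mem_mixedInterp.trans ⟨h.dneg_mem_leastModel, fun hp => hle hp⟩
  have hsub : I ⊆ {p | .pos p ∈ lm} := by
    refine h.le_of_le ?_ fun p hp => hle hp
    rw [mixedInterp_eq]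
    exact h.closedUnder_leastModel_survivingRules
  refine Set.Subset.antisymm ?_ hle
  calc extendInterp I = mixedInterp I I := (mixedInterp_self I).symm
    _ ⊆ mixedInterp {p | .pos p ∈ lm} I := mixedInterp_mono hsub
    _ = lm := mixedInterp_eq

theorem isStable_iff_isDynamicStableModel : IsStable P I ↔ IsDynamicStableModel [P] I :=
  ⟨IsStable.isDynamicStableModel, IsDynamicStableModel.isStable⟩

end ProgramBased

section BasicModels

variable {K : HybridKB D} {M : Set (Interp σ)}

theorem DynamicKB.isBasicDynamicModel_singleton_iff (hK : K.OntBased ∨ K.ProgBased) :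
    DynamicKB.IsBasicDynamicModel [K] M ↔ K.IsModel M := by
  simp only [IsBasicDynamicModel, OntBased, ProgBased, List.forall_mem_singleton, List.map_cons,
    List.map_nil, ← isStable_iff_isDynamicStableModel]
  constructor
  · rintro ⟨hne, ⟨hont, hM⟩ | ⟨hprog, hM⟩⟩
    exacts [hont.isModel_iff.2 ⟨hne, hM⟩, hprog.isModel_iff_isStable.2 hM]
  · intro hM
    exact ⟨hM.1.1, hK.imp (fun hont => ⟨hont, (hont.isModel_iff.1 hM).2⟩)
      fun hprog => ⟨hprog, hprog.isModel_iff_isStable.1 hM⟩⟩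

end BasicModels

section SplittingSequences

variable {K : HybridKB D} {X : Set (Interp σ)} {μ α : Ordinal.{u}} {U : Ordinal.{u} → Set σ.Pred}

/-- The index at which the predicate symbol `P` enters the sequence `U` (`0` if it never does). -/
noncomputable def level (U : Ordinal.{u} → Set σ.Pred) (P : σ.Pred) : Ordinal.{u} :=
  sInf {α | P ∈ U α}

theorem level_le {P : σ.Pred} (h : P ∈ U α) : level U P ≤ α :=
  csInf_le' h

namespace HybridKB

theorem IsSplittingSequence.exists_mem (h : K.IsSplittingSequence μ U) (P : σ.Pred) :
    ∃ α < μ, P ∈ U α := by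
  have hP : P ∈ ⋃ α < μ, U α := h.exhaustive ▸ Set.mem_univ P
  simpa only [Set.mem_iUnion, exists_prop] using hP

theorem IsSplittingSequence.level_lt (h : K.IsSplittingSequence μ U) (P : σ.Pred) :
    level U P < μ :=
  let ⟨_, hα, hP⟩ := h.exists_mem P
  (level_le hP).trans_lt hα

theorem IsSplittingSequence.mem_level (h : K.IsSplittingSequence μ U) (P : σ.Pred) :
    P ∈ U (level U P) :=
  let ⟨α, _, hP⟩ := h.exists_mem P
  csInf_mem (s := {α | P ∈ U α}) ⟨α, hP⟩

theorem IsSplittingSequence.preimage_level_Iic (h : K.IsSplittingSequence μ U) (hα : α < μ) :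
    level U ⁻¹' Set.Iic α = U α :=
  Set.Subset.antisymm (fun P hP => h.monotone _ _ hP hα (h.mem_level P)) fun _ => level_le

theorem IsSplittingSequence.not_isSuccLimit_level (h : K.IsSplittingSequence μ U) (P : σ.Pred) :
    ¬ Order.IsSuccLimit (level U P) := by
  intro hlim
  have hP := h.mem_level P
  rw [h.continuous _ (h.level_lt P) hlim] at hP
  obtain ⟨β, hβ, hPβ⟩ := Set.mem_iUnion₂.1 hP
  exact (level_le hPβ).not_gt hβ

theorem IsSplittingSequence.isStratified (h : K.IsSplittingSequence μ U) :
    K.IsStratified (level U) := by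
  intro α
  obtain hα | hα := lt_or_ge α μ
  · exact h.preimage_level_Iic hα ▸ h.splitting α hα
  · have huniv : level U ⁻¹' Set.Iic α = Set.univ :=
      Set.eq_univ_of_forall fun P => ((h.level_lt P).trans_le hα).le
    rw [huniv]
    exact ⟨fun _ _ _ => Set.subset_univ _, fun _ _ _ => Set.subset_univ _⟩

theorem top_empty (K : HybridKB D) : K.top ∅ = K := by
  have hont : (K.bottom ∅).ont = ∅ := Set.eq_empty_of_forall_notMem fun a ha =>
    (D.fo a).preds_nonempty.not_subset_empty ha.2
  have hprog : (K.bottom ∅).prog = ∅ := Set.eq_empty_of_forall_notMem fun r hr =>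
    hr.2 (.inl rfl : r.head.base.pred ∈ r.preds)
  simp only [top, hont, hprog, Set.sdiff_empty]

theorem isModel_reduct_empty_iff (hX : X.Nonempty) {M : Set (Interp σ)} :
    (K.reduct ∅ X).IsModel M ↔ K.IsModel M := by
  have satIn_iff (M' : Set (Interp σ)) : (K.reduct ∅ X).SatIn M' M ↔ K.SatIn M' M := by
    rw [satIn_reduct_iff hX, top_empty]
    simp [SatIn, Rule.SatIn]
  simp only [isModel_iff, satIn_iff]

theorem IsSplittingSequence.layer_zero (h : K.IsSplittingSequence μ U) :
    K.layer (level U) X 0 = (K.bottom (U 0)).reduct ∅ X := by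
  have hempty : level U ⁻¹' Set.Iio 0 = ∅ :=
    Set.eq_empty_of_forall_notMem fun P => not_lt_zero (a := level U P)
  rw [layer, h.preimage_level_Iic h.pos, hempty]

theorem IsSplittingSequence.layer_add_one (h : K.IsSplittingSequence μ U) (hα : α + 1 < μ) :
    K.layer (level U) X (α + 1) = (K.bottom (U (α + 1))).reduct (U α) X := by
  have hIio : Set.Iio (α + 1) = Set.Iic α := Set.ext fun β => Order.lt_add_one_iff (x := β)
  rw [layer, h.preimage_level_Iic hα, hIio, h.preimage_level_Iic ((lt_add_one α).trans hα)]

theorem IsSplittingSequence.isModel_layer_iff_eq_univ (h : K.IsSplittingSequence μ U)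
    (hα : ∀ P, level U P ≠ α) {M : Set (Interp σ)} :
    (K.layer (level U) X α).IsModel M ↔ M = Set.univ := by
  refine isModel_iff_eq_univ_of_predsIn_empty ?_
  rw [← Set.eq_empty_of_forall_notMem (s := level U ⁻¹' {α}) hα]
  exact h.isStratified.predsIn_layer

theorem Reducible.ontBased_or_progBased (h : K.Reducible ∅) : K.OntBased ∨ K.ProgBased := by
  refine h.imp_left fun h r hr => ⟨(h r hr).1, List.eq_nil_iff_forall_not_mem.2 fun L hL => ?_⟩
  exact litPreds_subset_iff.1 (h r hr).2 L hL

theorem Reducible.reduct_ontBased_or_progBased {V : Set σ.Pred} (h : (K.top V).Reducible V)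
    (X : Set (Interp σ)) : (K.reduct V X).OntBased ∨ (K.reduct V X).ProgBased := by
  refine h.imp_left ?_
  rintro h r' ⟨r, hr, -, hhead, hbody⟩
  obtain ⟨⟨p, hp⟩, hsub⟩ := h r hr
  refine ⟨⟨p, hhead.trans hp⟩, List.eq_nil_iff_forall_not_mem.2 fun L hL => ?_⟩
  have hL' : L ∈ r'.body := hL
  rw [hbody] at hL'
  exact hL'.2 rfl (litPreds_subset_iff.1 hsub L hL'.1)

end HybridKB

namespace DynamicKB

theorem isUpdateEnabling_singleton_iff : IsUpdateEnabling [K] μ U ↔ K.IsUpdateEnabling μ U := by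
  have reducible_singleton_iff {k : HybridKB D} {V : Set σ.Pred} :
      Reducible [k] V ↔ k.Reducible V := by
    simp only [Reducible, HybridKB.Reducible, List.forall_mem_singleton]
  constructor
  · rintro ⟨hsplit, hzero, hsucc⟩
    exact ⟨hsplit K (List.mem_singleton_self K), reducible_singleton_iff.1 hzero,
      fun α hα => reducible_singleton_iff.1 (hsucc α hα)⟩
  · rintro ⟨hsplit, hzero, hsucc⟩
    exact ⟨fun k hk => List.mem_singleton.1 hk ▸ hsplit, reducible_singleton_iff.2 hzero,
      fun α hα => reducible_singleton_iff.2 (hsucc α hα)⟩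

theorem isBasicDynamicModel_bottom_singleton_iff (hU : K.IsUpdateEnabling μ U)
    (hX : X.Nonempty) {N : Set (Interp σ)} :
    IsBasicDynamicModel (bottom (U 0) [K]) N ↔ (K.layer (level U) X 0).IsModel N := by
  rw [hU.isSplittingSequence.layer_zero, HybridKB.isModel_reduct_empty_iff hX]
  exact isBasicDynamicModel_singleton_iff hU.zero.ontBased_or_progBased

theorem isBasicDynamicModel_reduct_singleton_iff (hU : K.IsUpdateEnabling μ U)
    (hα : α + 1 < μ) {N : Set (Interp σ)} :
    IsBasicDynamicModel (reduct (U α) X (bottom (U (α + 1)) [K])) N ↔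
      (K.layer (level U) X (α + 1)).IsModel N := by
  rw [hU.isSplittingSequence.layer_add_one hα]
  exact isBasicDynamicModel_singleton_iff ((hU.succ α hα).reduct_ontBased_or_progBased X)

theorem isSolution_singleton_iff (hU : K.IsUpdateEnabling μ U)
    {X : Ordinal.{u} → Set (Interp σ)} (hX : (⋂ α < μ, X α).Nonempty) :
    IsSolution [K] μ U X ↔
      ∀ α < μ, (K.layer (level U) (⋂ η < α, X η) α).IsModel (X α) := by
  have hU' := hU.isSplittingSequence
  have iInter_lt_add_one (α : Ordinal.{u}) : ⋂ η < α + 1, X η = ⋂ η ≤ α, X η := by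
    simp only [Order.lt_add_one_iff]
  have isModel_limit_iff {α : Ordinal.{u}} (hα : Order.IsSuccLimit α) :=
    hU'.isModel_layer_iff_eq_univ (X := ⋂ η < α, X η) (M := X α)
      fun P hP => hU'.not_isSuccLimit_level P (hP ▸ hα)
  have iInter_lt_zero_nonempty : (⋂ η < (0 : Ordinal.{u}), X η).Nonempty :=
    hX.mono (Set.biInter_mono (fun _ hη => lt_trans hη hU'.pos) fun _ _ => subset_rfl)
  constructor
  · intro h α hα
    obtain rfl | ⟨β, rfl⟩ | hlim := Ordinal.zero_or_succ_or_isSuccLimit α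
    · exact (isBasicDynamicModel_bottom_singleton_iff hU iInter_lt_zero_nonempty).1 h.zero
    · rw [Order.succ_eq_add_one] at hα ⊢
      rw [iInter_lt_add_one]
      exact (isBasicDynamicModel_reduct_singleton_iff hU hα).1 (h.succ β hα)
    · exact (isModel_limit_iff hlim).2 (h.limit α hα hlim)
  · intro h
    refine ⟨fun α hα => hX.mono (Set.biInter_subset_of_mem hα),
      (isBasicDynamicModel_bottom_singleton_iff hU iInter_lt_zero_nonempty).2 (h 0 hU'.pos),
      fun α hα => ?_, fun α hα hlim => (isModel_limit_iff hlim).1 (h α hα)⟩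
    rw [isBasicDynamicModel_reduct_singleton_iff hU hα, ← iInter_lt_add_one]
    exact h (α + 1) hα

theorem isDynamicModelWrt_singleton_iff (hU : K.IsUpdateEnabling μ U) {M : Set (Interp σ)} :
    IsDynamicModelWrt [K] μ U M ↔ K.IsModel M := by
  have hU' := hU.isSplittingSequence
  have isModel_iff_eq_univ {α : Ordinal.{u}} (hα : ¬ α < μ) {Y N : Set (Interp σ)} :
      (K.layer (level U) Y α).IsModel N ↔ N = Set.univ :=
    hU'.isModel_layer_iff_eq_univ fun P hP => hα (hP.symm.trans_lt (hU'.level_lt P))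
  constructor
  · rintro ⟨hne, X, hX, rfl⟩
    rw [isSolution_singleton_iff hU hne] at hX
    refine (hU'.isStratified.isModel_iff hne).2 ⟨fun α => ⋂ _ : α < μ, X α, fun α => ?_, rfl⟩
    by_cases hα : α < μ
    · have hlow : ⋂ η < α, ⋂ _ : η < μ, X η = ⋂ η < α, X η :=
        Set.iInter₂_congr fun η hη => iInf_pos (hη.trans hα)
      simpa only [hlow, hα, Set.iInter_true] using hX α hα
    · simp only [isModel_iff_eq_univ hα, hα, Set.iInter_false]
  · intro hM
    have hne : M.Nonempty := hM.1.1
    obtain ⟨X, hX, rfl⟩ := (hU'.isStratified.isModel_iff hne).1 hM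
    have iInter_eq : ⋂ α, X α = ⋂ α < μ, X α := by
      refine Set.iInter_congr fun α => ?_
      by_cases hα : α < μ
      · simp only [hα, Set.iInter_true]
      · simpa only [hα, Set.iInter_false] using (isModel_iff_eq_univ hα).1 (hX α)
    exact ⟨hne, X, (isSolution_singleton_iff hU (iInter_eq ▸ hne)).2 fun α _ => hX α, iInter_eq⟩

end DynamicKB

end SplittingSequences

end HybridMKNF

theorem mainTheorem4 {σ : HybridMKNF.Signature.{u, v}}
    {D : HybridMKNF.DescriptionLogic.{u, v, w} σ} (K : HybridMKNF.HybridKB D) (hK : K.Updatable)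
    (M : Set (HybridMKNF.Interp σ)) (hM : M.Nonempty) :
    HybridMKNF.DynamicKB.IsDynamicModel [K] M ↔ K.IsModel M := by
  constructor
  · rintro ⟨μ, U, hU, hmodel⟩
    rw [HybridMKNF.DynamicKB.isUpdateEnabling_singleton_iff] at hU
    exact (HybridMKNF.DynamicKB.isDynamicModelWrt_singleton_iff hU).1 hmodel
  · intro hmodel
    obtain ⟨μ, U, hU⟩ := hK
    exact ⟨μ, U, HybridMKNF.DynamicKB.isUpdateEnabling_singleton_iff.2 hU,
      (HybridMKNF.DynamicKB.isDynamicModelWrt_singleton_iff hU).2 hmodel⟩
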